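/- Let $\mathbb{R}_{\max}=\mathbb{R}\cup\{-\infty\}$ with its order topology. Let $S$ be a countable set and $A:S\times S\to\mathbb{R}_{\max}$. The weight of a path $i_0,\dots,i_n$ in $S$ is $A_{i_0i_1}+\dots+A_{i_{n-1}i_n}$ (and $0$ if $n=0$). For $i,j\in S$ let $A^*_{ij}$ be the supremum of the weights of all paths from $i$ to $j$ of length $n\ge 0$, and let $A^+_{ij}$ be the supremum over paths of length $n\ge 1$. Assume that $b\in S$ is a basepoint from which every state is accessible, that is, $A^*_{bj}>-\infty$ for all $j\in S$, and that $A^*_{bj}<+\infty$ for all $j\in S$. Put $K_{ij}:=A^*_{ij}-A^*_{bj}$, let $\mathscr{K}:=\{K_{\cdot j}: j\in S\}$, and let the Martin space $\mathscr{M}$ be the closure of $\mathscr{K}$ in $\mathbb{R}_{\max}^S$ with the product topology. The minimal Martin space is $$\mathscr{M}^m:=\{w\in\mathscr{M}: H^\flat(w,w)=0\},\qquad H^\flat(z,w):=\limsup_{K_{\cdot i}\to z}\ \liminf_{K_{\cdot j}\to w}\ \bigl(A^*_{bi}+A^+_{ij}-A^*_{bj}\bigr),$$ where $\limsup_{K_{\cdot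 j}\to w}f_j:=\inf_{W\ni w}\sup_{K_{\cdot j}\in W}f_j$ and $\liminf_{K_{\cdot j}\to w}f_j:=\sup_{W\ni w}\inf_{K_{\cdot j}\in W}f_j$, with $W$ ranging over the open neighbourhoods of $w$ in $\mathscr{M}$. A max-plus measure on a set $D\subseteq\mathscr{M}$ is an upper semicontinuous map $\nu:D\to\mathbb{R}_{\max}$; it represents $u\in\mathbb{R}_{\max}^S$ if $u_i=\sup_{\xi\in D}(\xi_i+\nu(\xi))$ for all $i\in S$. Max-plus measures on $D$ are ordered pointwise. Let $u\in\mathbb{R}_{\max}^S$ be max-plus superharmonic, that is, $u_i\ge\sup_{j\in S}(A_{ij}+u_j)$ for all $i\in S$. Then among the max-plus measures on $\mathscr{K}\cup\mathscr{M}^m$ representing $u$ there is a least one, $\mu^{\min}_u$. If, moreover, $u$ is max-plus harmonic, that is, $u_i=\sup_{j\in S}(A_{ij}+u_j)$ for all $i\in S$, then the restriction of $\mu^{\min}_u$ to $\mathscr{M}^m$ represents $u$ and is the least of the max-plus measures on $\mathscr{M}^m$ representing $u$. -/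

import Mathlib

/-! Max-plus potential theory.  The max-plus semifield `ℝ ∪ {-∞}` is modelled by the elements of
`EReal` other than `⊤`; its topology is the one induced from the order topology of `EReal`,
and vectors `S → EReal` carry the product topology. -/

namespace MaxPlus

variable {S : Type*}

/-- The weight `A (p 0) (p 1) + ⋯ + A (p (n-1)) (p n)` of the path `p 0, …, p n` of length `n`. -/
noncomputable def pathWeight (A : S → S → EReal) (p : ℕ → S) (n : ℕ) : EReal :=
  ∑ l ∈ Finset.range n, A (p l) (p (l + 1))

/-- The Green kernel `A*`: the supremum of the weights of all paths from `i` to `j`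
(including, when `i = j`, the path of length zero, which has weight `0`). -/
noncomputable def green (A : S → S → EReal) (i j : S) : EReal :=
  sSup {x | ∃ (n : ℕ) (p : ℕ → S), p 0 = i ∧ p n = j ∧ x = pathWeight A p n}

/-- The kernel `A⁺`: the supremum of the weights of all paths of length at least one
from `i` to `j`. -/
noncomputable def greenPlus (A : S → S → EReal) (i j : S) : EReal :=
  sSup {x | ∃ (n : ℕ) (p : ℕ → S), 1 ≤ n ∧ p 0 = i ∧ p n = j ∧ x = pathWeight A p n}

/-- The column `K_{·j} = A*_{·j} - A*_{bj}` of the Martin kernel with basepoint `b`. -/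
noncomputable def martinKernel (A : S → S → EReal) (b j : S) : S → EReal :=
  fun i => green A i j - green A b j

/-- The set `𝒦` of all columns of the Martin kernel. -/
noncomputable def columns (A : S → S → EReal) (b : S) : Set (S → EReal) :=
  Set.range (martinKernel A b)

/-- The Martin space `ℳ`: the closure of `𝒦` in the product topology. -/
noncomputable def martinSpace (A : S → S → EReal) (b : S) : Set (S → EReal) :=
  closure (columns A b)

/-- The filter on `S` of sets containing `{j | K_{·j} ∈ W}` for some neighbourhood `W` of `w`.
Thus `limsup f (nearPoint A b w)` is the infimum over the neighbourhoods `W` of `w` of the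
supremum of `f j` over the states `j` with `K_{·j} ∈ W`, and dually for `liminf`. -/
noncomputable def nearPoint (A : S → S → EReal) (b : S) (w : S → EReal) : Filter S :=
  Filter.comap (martinKernel A b) (nhds w)

/-- `H♭(z,w) = limsup_{K_{·i} → z} liminf_{K_{·j} → w} (A*_{bi} + A⁺_{ij} - A*_{bj})`. -/
noncomputable def Hflat (A : S → S → EReal) (b : S) (z w : S → EReal) : EReal :=
  Filter.limsup
    (fun i => Filter.liminf
      (fun j => green A b i + greenPlus A i j - green A b j) (nearPoint A b w))
    (nearPoint A b z)

/-- The minimal Martin space `ℳᵐ`. -/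
noncomputable def minimalMartinSpace (A : S → S → EReal) (b : S) : Set (S → EReal) :=
  {w | w ∈ martinSpace A b ∧ Hflat A b w w = 0}

/-- `u_i ≥ sup_j (A_{ij} + u_j)` for all `i`. -/
def IsSuperharmonic (A : S → S → EReal) (u : S → EReal) : Prop :=
  ∀ i, ⨆ j, (A i j + u j) ≤ u i

/-- `u_i = sup_j (A_{ij} + u_j)` for all `i`. -/
def IsHarmonic (A : S → S → EReal) (u : S → EReal) : Prop :=
  ∀ i, u i = ⨆ j, (A i j + u j)

/-- A max-plus measure on a set `D` of vectors, identified with its density: an upper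
semicontinuous map from `D` to `ℝ ∪ {-∞}`. -/
structure Measure (D : Set (S → EReal)) where
  density : D → EReal
  ne_top : ∀ ξ, density ξ ≠ ⊤
  usc : UpperSemicontinuous density

/-- Max-plus measures are compared through their densities, pointwise. -/
instance (D : Set (S → EReal)) : LE (Measure D) where
  le μ ν := ∀ ξ, μ.density ξ ≤ ν.density ξ

/-- `ν` represents `u` if `u = sup_{ξ ∈ D} (ξ + ν(ξ))`. -/
def Measure.Represents {D : Set (S → EReal)} (ν : Measure D) (u : S → EReal) : Prop :=
  ∀ i, u i = ⨆ ξ : D, (ξ.1 i + ν.density ξ)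

/-- The restriction of a max-plus measure to a smaller set. -/
def Measure.restrict {D E : Set (S → EReal)} (h : E ⊆ D) (μ : Measure D) : Measure E where
  density := fun ξ => μ.density (Set.inclusion h ξ)
  ne_top := fun ξ => μ.ne_top (Set.inclusion h ξ)
  usc := μ.usc.comp (continuous_inclusion h)

end MaxPlus

/-!
The least representing measure is the pointwise infimum of all measures on `𝒦 ∪ ℳᵐ` representing
`u`. There is at least one: the upper semicontinuous hull of the weights `A*_{bj} + u_j` placed at
the columns `K_{·j}` (`exists_represents`). An infimum of upper semicontinuous functions is upper
semicontinuous, so the point is that the infimum still represents `u`. By the Lindelöf property it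
is the infimum of a sequence `ν n` of representing measures (`exists_seq_iInf_eq`), and it suffices
to find, for every real `α < u i`, a single point `w` with `α ≤ w i + ν n w` for all `n`
(`exists_common_point`).

Such a `w` is the limit of a chain of states (`exists_link`, `exists_chain`). Suppose the chain has
reached a state `k`, with a real `v < u k`. As the next measure `ν n` represents `u`, some `ξ` has
`v < ξ k + ν n ξ`; as `ξ` is in `𝒦 ∪ ℳᵐ`, its value at `k` is nearly attained by passing through a
state `k'` whose column is as close to `ξ` as desired (`exists_lt_green_add`), and then
`v ≤ A*_{kk'} + v'` for some `v' < u k'`. Along the chain, `A*_{j k_n} + v_n` increases with `n` for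
each `j`, so the columns `K_{·k_n}` converge to some `w` and `A*_{b k_n} + v_n` to some real `a`,
with `α ≤ w i + a` (`exists_limit_of_chain`). The points `ξ n` converge to `w` too, and the measures are
scheduled so that each occurs infinitely often; upper semicontinuity then gives `a ≤ ν n w` for
every `n`. The chain also shows that `w` is in `𝒦 ∪ ℳᵐ`, since `A*_{b k_n} + w_{k_n}` tends to `0`
(`mem_columns_union_minimal_of_chain`).

When `u` is harmonic, the links can be taken of positive length, that is, with `A⁺` in place of
`A*`. The limit is then in `ℳᵐ` (`mem_minimal_of_chain`), so the restriction of the infimum to `ℳᵐ`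
represents `u`. It is least there because every measure on `ℳᵐ` representing `u` extends, by its
upper semicontinuous hull, to one on `𝒦 ∪ ℳᵐ` (`Measure.Represents.exists_extension`).
-/

namespace MaxPlus

variable {S : Type*} {A : S → S → EReal} {b : S} {p : S → ℝ} {u : S → EReal}

/-! ### The Green kernels -/

/-- Paths are infinite sequences read up to their length, so the concatenation agrees with `p` up to
the index `m` and with the shift of `q` from there on. -/
theorem exists_concat (A : S → S → EReal) {p q : ℕ → S} {m n : ℕ} (h : p m = q 0) :
    ∃ r : ℕ → S, r 0 = p 0 ∧ r (m + n) = q n ∧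
      pathWeight A r (m + n) = pathWeight A p m + pathWeight A q n := by
  have hr : ∀ l, (if m + l ≤ m then p (m + l) else q (m + l - m)) = q l := by
    intro l
    split_ifs with hl
    · obtain rfl : l = 0 := by omega
      simpa using h
    · simp
  refine ⟨fun l => if l ≤ m then p l else q (l - m), by simp, hr n, ?_⟩
  rw [pathWeight, Finset.sum_range_add]
  congr 1
  · refine Finset.sum_congr rfl fun l hl => ?_
    have hl : l < m := by simpa using hl
    simp [hl.le, Nat.succ_le_of_lt hl]
  · refine Finset.sum_congr rfl fun l _ => ?_
    have h2 := hr (l + 1)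
    rw [← add_assoc] at h2
    simp only [hr, h2]

theorem pathWeight_le_green (A : S → S → EReal) (q : ℕ → S) (n : ℕ) :
    pathWeight A q n ≤ green A (q 0) (q n) :=
  le_sSup ⟨n, q, rfl, rfl, rfl⟩

theorem pathWeight_le_greenPlus (A : S → S → EReal) (q : ℕ → S) {n : ℕ} (hn : 1 ≤ n) :
    pathWeight A q n ≤ greenPlus A (q 0) (q n) :=
  le_sSup ⟨n, q, hn, rfl, rfl, rfl⟩

theorem greenPlus_le_green (A : S → S → EReal) (i j : S) : greenPlus A i j ≤ green A i j :=
  sSup_le_sSup fun _ ⟨n, q, _, h⟩ => ⟨n, q, h⟩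

theorem le_greenPlus (A : S → S → EReal) (i j : S) : A i j ≤ greenPlus A i j := by
  simpa [pathWeight] using
    pathWeight_le_greenPlus A (fun l => if l = 0 then i else j) (le_refl 1)

theorem green_self_nonneg (A : S → S → EReal) (i : S) : 0 ≤ green A i i := by
  simpa [pathWeight] using pathWeight_le_green A (fun _ => i) 0

theorem green_add_green_le (A : S → S → EReal) (i j k : S) :
    green A i j + green A j k ≤ green A i k := by
  refine EReal.add_le_of_forall_lt fun x hx y hy => ?_
  obtain ⟨_, ⟨m, q, rfl, hq, rfl⟩, hx⟩ := lt_sSup_iff.1 hx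
  obtain ⟨_, ⟨n, r, hr, rfl, rfl⟩, hy⟩ := lt_sSup_iff.1 hy
  obtain ⟨t, ht0, htn, ht⟩ := exists_concat A (n := n) (hq.trans hr.symm)
  refine (add_le_add hx.le hy.le).trans ?_
  rw [← ht, ← ht0, ← htn]
  exact pathWeight_le_green A t _

theorem greenPlus_add_green_le (A : S → S → EReal) (i j k : S) :
    greenPlus A i j + green A j k ≤ greenPlus A i k := by
  refine EReal.add_le_of_forall_lt fun x hx y hy => ?_
  obtain ⟨_, ⟨m, q, hm, rfl, hq, rfl⟩, hx⟩ := lt_sSup_iff.1 hx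
  obtain ⟨_, ⟨n, r, hr, rfl, rfl⟩, hy⟩ := lt_sSup_iff.1 hy
  obtain ⟨t, ht0, htn, ht⟩ := exists_concat A (n := n) (hq.trans hr.symm)
  refine (add_le_add hx.le hy.le).trans ?_
  rw [← ht, ← ht0, ← htn]
  exact pathWeight_le_greenPlus A t (by omega)

theorem green_add_greenPlus_le (A : S → S → EReal) (i j k : S) :
    green A i j + greenPlus A j k ≤ greenPlus A i k := by
  refine EReal.add_le_of_forall_lt fun x hx y hy => ?_
  obtain ⟨_, ⟨m, q, rfl, hq, rfl⟩, hx⟩ := lt_sSup_iff.1 hx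
  obtain ⟨_, ⟨n, r, hn, hr, rfl, rfl⟩, hy⟩ := lt_sSup_iff.1 hy
  obtain ⟨t, ht0, htn, ht⟩ := exists_concat A (n := n) (hq.trans hr.symm)
  refine (add_le_add hx.le hy.le).trans ?_
  rw [← ht, ← ht0, ← htn]
  exact pathWeight_le_greenPlus A t (by omega)

theorem greenPlus_eq_green_of_ne (A : S → S → EReal) {i j : S} (h : i ≠ j) :
    greenPlus A i j = green A i j := by
  refine (greenPlus_le_green A i j).antisymm (sSup_le ?_)
  rintro _ ⟨n, q, rfl, rfl, rfl⟩
  refine pathWeight_le_greenPlus A q (Nat.one_le_iff_ne_zero.2 ?_)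
  rintro rfl
  exact h rfl

theorem greenPlus_eq_green_of_nonneg {m : S} (hm : 0 ≤ greenPlus A m m) (j : S) :
    greenPlus A m j = green A m j := by
  refine (greenPlus_le_green A m j).antisymm ?_
  calc green A m j = 0 + green A m j := (zero_add _).symm
    _ ≤ greenPlus A m m + green A m j := by gcongr
    _ ≤ greenPlus A m j := greenPlus_add_green_le A m m j

theorem IsSuperharmonic.pathWeight_add_le (hu : IsSuperharmonic A u) (q : ℕ → S) (n : ℕ) :
    pathWeight A q n + u (q n) ≤ u (q 0) := by
  induction n with
  | zero => simp [pathWeight]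
  | succ n ih =>
    rw [pathWeight, Finset.sum_range_succ, add_assoc]
    refine le_trans ?_ ih
    rw [pathWeight]
    gcongr
    exact (le_iSup (fun j => A (q n) j + u j) _).trans (hu _)

theorem IsSuperharmonic.green_add_le (hu : IsSuperharmonic A u) (i j : S) :
    green A i j + u j ≤ u i := by
  refine EReal.add_le_of_forall_lt fun x hx y hy => ?_
  obtain ⟨_, ⟨n, q, rfl, rfl, rfl⟩, hx⟩ := lt_sSup_iff.1 hx
  exact (add_le_add hx.le hy.le).trans (hu.pathWeight_add_le q n)

/-! ### Finiteness and the Martin kernel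

From here on, the potential `A*_{b·}` of the basepoint is a real-valued function `p`. -/

theorem green_le (hp : ∀ j, green A b j = p j) (i j : S) :
    green A i j ≤ ((p j - p i : ℝ) : EReal) := by
  have h := green_add_green_le A b i j
  rw [hp, hp, add_comm] at h
  rw [EReal.coe_sub]
  exact (EReal.le_sub_iff_add_le (by simp) (by simp)).2 h

theorem green_ne_top (hp : ∀ j, green A b j = p j) (i j : S) : green A i j ≠ ⊤ :=
  ((green_le hp i j).trans_lt (EReal.coe_lt_top _)).ne

theorem green_self (hp : ∀ j, green A b j = p j) (i : S) : green A i i = 0 :=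
  le_antisymm (by simpa using green_le hp i i) (green_self_nonneg A i)

theorem martinKernel_apply (hp : ∀ j, green A b j = p j) (i j : S) :
    martinKernel A b j i = green A i j - p j := by
  rw [martinKernel, hp]

theorem martinKernel_add (hp : ∀ j, green A b j = p j) (i j : S) :
    martinKernel A b j i + p j = green A i j := by
  rw [martinKernel_apply hp, EReal.sub_add_cancel]

theorem martinKernel_add_add (hp : ∀ j, green A b j = p j) (i j : S) (x : EReal) :
    martinKernel A b j i + (p j + x) = green A i j + x := by
  rw [← add_assoc, martinKernel_add hp]

theorem nearPoint_neBot {w : S → EReal} (hw : w ∈ martinSpace A b) : (nearPoint A b w).NeBot := by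
  rw [nearPoint, Filter.comap_neBot_iff]
  intro t ht
  obtain ⟨_, h, j, rfl⟩ := mem_closure_iff_nhds.1 hw t ht
  exact ⟨j, h⟩

theorem tendsto_nearPoint (A : S → S → EReal) (b i : S) (w : S → EReal) :
    Filter.Tendsto (fun j => martinKernel A b j i) (nearPoint A b w) (nhds (w i)) :=
  ((continuous_apply i).tendsto w).comp Filter.tendsto_comap

theorem apply_le_of_mem_martinSpace (hp : ∀ j, green A b j = p j) {w : S → EReal}
    (hw : w ∈ martinSpace A b) (i : S) : w i ≤ ((-p i : ℝ) : EReal) := by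
  have := nearPoint_neBot hw
  refine le_of_tendsto' (tendsto_nearPoint A b i w) fun j => ?_
  rw [martinKernel_apply hp, EReal.sub_le_iff_le_add (by simp) (by simp), ← EReal.coe_add]
  convert green_le hp i j using 2
  ring

theorem apply_basepoint_of_mem_martinSpace (hp : ∀ j, green A b j = p j) {w : S → EReal}
    (hw : w ∈ martinSpace A b) : w b = 0 := by
  have := nearPoint_neBot hw
  refine tendsto_nhds_unique (tendsto_nearPoint A b b w) ?_
  have : (fun j => martinKernel A b j b) = fun _ => (0 : EReal) := by
    funext j
    rw [martinKernel_apply hp, hp, ← EReal.coe_sub, sub_self, EReal.coe_zero]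
  rw [this]
  exact tendsto_const_nhds

/-! ### The minimal Martin space -/

theorem tendsto_add_green_sub (hp : ∀ j, green A b j = p j) (i : S) (w : S → EReal) :
    Filter.Tendsto (fun j => green A b i + green A i j - green A b j) (nearPoint A b w)
      (nhds (p i + w i)) := by
  have h : (fun j => green A b i + green A i j - green A b j) =
      fun j => (p i : EReal) + martinKernel A b j i := by
    funext j
    rw [hp, hp, martinKernel_apply hp, sub_eq_add_neg, sub_eq_add_neg, add_assoc]
  rw [h]
  exact (EReal.continuousAt_add (p := ((p i : EReal), w i)) (by simp) (by simp)).tendsto.comp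
    (tendsto_const_nhds.prodMk_nhds (tendsto_nearPoint A b i w))

theorem liminf_le_add (hp : ∀ j, green A b j = p j) (i : S) {w : S → EReal}
    (hw : w ∈ martinSpace A b) :
    Filter.liminf (fun j => green A b i + greenPlus A i j - green A b j) (nearPoint A b w) ≤
      p i + w i := by
  have := nearPoint_neBot hw
  rw [← (tendsto_add_green_sub hp i w).liminf_eq]
  refine Filter.liminf_le_liminf (Filter.Eventually.of_forall fun j => ?_)
  exact EReal.sub_le_sub (add_le_add le_rfl (greenPlus_le_green A i j)) le_rfl

/-- Near a point of the minimal Martin space there are states `i` at which the normalised value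
`p i + w i` is nearly `0`, its largest possible value. -/
theorem exists_near_of_mem_minimal (hp : ∀ j, green A b j = p j) {w : S → EReal}
    (hw : w ∈ minimalMartinSpace A b) {c : EReal} (hc : c < 0) {P : S → Prop}
    (hP : ∀ᶠ i in nearPoint A b w, P i) : ∃ i, P i ∧ c < p i + w i := by
  have h : c < Hflat A b w w := by rw [hw.2]; exact hc
  obtain ⟨i, hi, hPi⟩ := ((Filter.frequently_lt_of_lt_limsup (by isBoundedDefault) h).and_eventually
    hP).exists
  exact ⟨i, hPi, hi.trans_le (liminf_le_add hp i hw.1)⟩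

theorem mem_minimal_of_forall_lt (hp : ∀ j, green A b j = p j) {w : S → EReal}
    (hw : w ∈ martinSpace A b)
    (h : ∀ c < (0 : EReal), ∃ᶠ i in nearPoint A b w,
      (∀ᶠ j in nearPoint A b w, greenPlus A i j = green A i j) ∧ c < p i + w i) :
    w ∈ minimalMartinSpace A b := by
  have := nearPoint_neBot hw
  refine ⟨hw, le_antisymm ?_ (le_of_forall_lt fun c hc => ?_)⟩
  · refine Filter.limsup_le_of_le (by isBoundedDefault) (Filter.Eventually.of_forall fun i => ?_)
    refine (liminf_le_add hp i hw).trans ?_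
    calc (p i : EReal) + w i ≤ p i + ((-p i : ℝ) : EReal) := by
          gcongr; exact apply_le_of_mem_martinSpace hp hw i
      _ = 0 := by rw [← EReal.coe_add, add_neg_cancel, EReal.coe_zero]
  · obtain ⟨d, hcd, hd⟩ := exists_between hc
    refine hcd.trans_le (Filter.le_limsup_of_frequently_le ((h d hd).mono fun i hi => ?_)
      (by isBoundedDefault))
    rw [Filter.liminf_congr (v := fun j => green A b i + green A i j - green A b j)
      (hi.1.mono fun j hj => by rw [hj]), (tendsto_add_green_sub hp i w).liminf_eq]
    exact hi.2.le

/-- A column lies in the minimal Martin space as soon as its state lies on closed paths of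
positive length whose weights come arbitrarily close to `0`. -/
theorem martinKernel_mem_minimal (hp : ∀ j, green A b j = p j) {m : S}
    (hm : 0 ≤ greenPlus A m m) : martinKernel A b m ∈ minimalMartinSpace A b := by
  refine mem_minimal_of_forall_lt hp (subset_closure ⟨m, rfl⟩) fun c hc => ?_
  have hpure : pure m ≤ nearPoint A b (martinKernel A b m) :=
    Filter.map_le_iff_le_comap.1 (by simp)
  refine Filter.Frequently.filter_mono (f := pure m) ?_ hpure
  rw [Filter.frequently_pure]
  refine ⟨Filter.Eventually.of_forall (greenPlus_eq_green_of_nonneg hm), ?_⟩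
  rw [add_comm, martinKernel_add hp, green_self hp]
  exact hc

/-- Every value of a vector of `𝒦 ∪ ℳᵐ` is nearly attained by passing through a state whose
column is close to that vector. -/
theorem exists_lt_green_add (hp : ∀ j, green A b j = p j) {w : S → EReal}
    (hw : w ∈ columns A b ∪ minimalMartinSpace A b) {W : Set (S → EReal)} (hW : W ∈ nhds w)
    (k : S) {c : EReal} (hc : c < w k) :
    ∃ i, martinKernel A b i ∈ W ∧ c < green A k i + w i := by
  rcases hw with ⟨i, rfl⟩ | hw
  · refine ⟨i, mem_of_mem_nhds hW, ?_⟩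
    rwa [martinKernel_apply hp i i, green_self hp, zero_sub, ← sub_eq_add_neg,
      ← martinKernel_apply hp]
  · obtain ⟨c₁, hc₁, h₁⟩ := EReal.lt_iff_exists_real_btwn.1 hc
    obtain ⟨c₂, hc₂, h₂⟩ := EReal.lt_iff_exists_real_btwn.1 h₁
    have hlt : c₁ < c₂ := EReal.coe_lt_coe_iff.1 hc₂
    obtain ⟨i, ⟨hiW, hik⟩, hi⟩ := exists_near_of_mem_minimal hp hw
      (c := ((c₁ - c₂ : ℝ) : EReal)) (by exact_mod_cast sub_neg.2 hlt)
      (((Filter.eventually_mem_set.2 (Filter.preimage_mem_comap hW)).and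
        ((tendsto_nearPoint A b k w).eventually_const_lt h₂)))
    refine ⟨i, hiW, hc₁.trans ?_⟩
    calc (c₁ : EReal) = ((c₂ : ℝ) : EReal) + ((c₁ - c₂ : ℝ) : EReal) := by
          rw [← EReal.coe_add]; congr 1; ring
      _ < martinKernel A b i k + (p i + w i) := EReal.add_lt_add hik hi
      _ = _ := martinKernel_add_add hp k i _

/-! ### Upper semicontinuous hulls -/

/-- The upper semicontinuous hull of a family of weights `f t` placed at the points `x t`:
its value at `w` is the limsup of `f t` as `x t → w`. -/
noncomputable def hull {T X : Type*} [TopologicalSpace X] (x : T → X) (f : T → EReal) (w : X) :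
    EReal :=
  Filter.limsup f (Filter.comap x (nhds w))

section Hull

variable {T X : Type*} [TopologicalSpace X] {x : T → X} {f : T → EReal}

theorem upperSemicontinuous_hull (x : T → X) (f : T → EReal) :
    UpperSemicontinuous (hull x f) := by
  intro w c hc
  obtain ⟨d, hd, hdc⟩ := exists_between hc
  have h := Filter.eventually_comap.1
    (Filter.eventually_lt_of_limsup_lt hd (by isBoundedDefault))
  filter_upwards [eventually_eventually_nhds.2 h] with y hy
  refine lt_of_le_of_lt (Filter.limsup_le_of_le (by isBoundedDefault) ?_) hdc
  exact Filter.eventually_comap.2 (hy.mono fun z hz t ht => (hz t ht).le)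

theorem le_hull (x : T → X) (f : T → EReal) (t : T) : f t ≤ hull x f (x t) := by
  have hpure : pure t ≤ Filter.comap x (nhds (x t)) :=
    Filter.map_le_iff_le_comap.1 (by simpa using pure_le_nhds _)
  refine Filter.le_limsup_of_frequently_le
    (Filter.Frequently.filter_mono (f := pure t) ?_ hpure) (by isBoundedDefault)
  simp

theorem hull_eq_of_upperSemicontinuous {E : Set X} {f : E → EReal} (hf : UpperSemicontinuous f)
    (t : E) : hull Subtype.val f t = f t := by
  refine le_antisymm (le_of_forall_gt fun c hc => ?_) (le_hull Subtype.val f t)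
  obtain ⟨d, hd, hdc⟩ := exists_between hc
  refine lt_of_le_of_lt (Filter.limsup_le_of_le (by isBoundedDefault) ?_) hdc
  rw [← nhds_subtype_eq_comap]
  exact (hf t d hd).mono fun _ h => h.le

theorem apply_add_hull_le {x : T → S → EReal} (h : ∀ t i, x t i + f t ≤ u i) (w : S → EReal)
    (i : S) : w i + hull x f w ≤ u i := by
  refine EReal.add_le_of_forall_lt fun c hc d hd => ?_
  have hx : Filter.Tendsto (fun t => x t i) (Filter.comap x (nhds w)) (nhds (w i)) :=
    ((continuous_apply i).tendsto w).comp Filter.tendsto_comap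
  obtain ⟨t, ht, ht'⟩ := ((Filter.frequently_lt_of_lt_limsup (by isBoundedDefault)
    hd).and_eventually (hx.eventually_const_lt hc)).exists
  exact (add_le_add ht'.le ht.le).trans (h t i)

/-- The restriction of a hull to a set of vectors with value `0` at `b`, as a max-plus measure. -/
noncomputable def hullMeasure {x : T → S → EReal} {D : Set (S → EReal)} (hD : ∀ w ∈ D, w b = 0)
    (hu : u b ≠ ⊤) (h : ∀ t i, x t i + f t ≤ u i) : Measure D where
  density w := hull x f w
  ne_top w := by
    have h₁ := apply_add_hull_le h w.1 b
    rw [hD w.1 w.2, zero_add] at h₁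
    exact (h₁.trans_lt hu.lt_top).ne
  usc := (upperSemicontinuous_hull x f).comp continuous_subtype_val

theorem hullMeasure_represents {x : T → S → EReal} {D : Set (S → EReal)}
    (hD : ∀ w ∈ D, w b = 0) (hu : u b ≠ ⊤) (h : ∀ t i, x t i + f t ≤ u i)
    (hx : ∀ t, x t ∈ D) (hle : ∀ i, u i ≤ ⨆ t, x t i + f t) :
    (hullMeasure hD hu h).Represents u := by
  refine fun i => le_antisymm ((hle i).trans (iSup_le fun t => ?_))
    (iSup_le fun w => apply_add_hull_le h w.1 i)
  refine le_trans ?_ (le_iSup _ (⟨x t, hx t⟩ : D))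
  exact add_le_add le_rfl (le_hull x f t)

end Hull

theorem Measure.Represents.apply_add_le {D : Set (S → EReal)} {ν : Measure D}
    (hν : ν.Represents u) (w : D) (i : S) : w.1 i + ν.density w ≤ u i := by
  rw [hν i]
  exact le_iSup (fun w : D => w.1 i + ν.density w) w

theorem apply_basepoint_of_mem_union (hp : ∀ j, green A b j = p j) {w : S → EReal}
    (hw : w ∈ columns A b ∪ minimalMartinSpace A b) : w b = 0 :=
  apply_basepoint_of_mem_martinSpace hp
    (hw.elim (fun h => subset_closure h) fun h => h.1)

theorem exists_represents (hp : ∀ j, green A b j = p j) (hub : u b ≠ ⊤)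
    (hu : IsSuperharmonic A u) :
    ∃ ν : Measure (columns A b ∪ minimalMartinSpace A b), ν.Represents u := by
  refine ⟨hullMeasure (x := martinKernel A b) (f := fun j => p j + u j)
    (fun w hw => apply_basepoint_of_mem_union hp hw) hub (fun j i => ?_),
    hullMeasure_represents _ _ _ (fun j => Or.inl ⟨j, rfl⟩) fun i => ?_⟩
  · rw [martinKernel_add_add hp]
    exact hu.green_add_le i j
  · refine le_trans ?_ (le_iSup _ i)
    rw [martinKernel_add_add hp, green_self hp, zero_add]

/-- A measure on `E` representing `u` extends to a representing measure on any larger set of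
vectors with value `0` at `b`. -/
theorem Measure.Represents.exists_extension {D E : Set (S → EReal)} (hED : E ⊆ D)
    (hD : ∀ w ∈ D, w b = 0) (hub : u b ≠ ⊤) {ν : Measure E} (hν : ν.Represents u) :
    ∃ ν' : Measure D, ν'.Represents u ∧
      ∀ w : E, ν'.density (Set.inclusion hED w) = ν.density w :=
  ⟨hullMeasure (x := fun w : E => w.1) hD hub hν.apply_add_le,
    hullMeasure_represents _ _ _ (fun w => hED w.2) fun i => (hν i).le,
    fun w => hull_eq_of_upperSemicontinuous ν.usc w⟩

/-! ### Infima of families of measures -/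

/-- By the Lindelöf property, the pointwise infimum of upper semicontinuous functions on a
second countable space is the infimum of a sequence of them. -/
theorem exists_seq_iInf_eq {X ι : Type*} [TopologicalSpace X] [SecondCountableTopology X]
    [Nonempty ι] {f : ι → X → EReal} (hf : ∀ a, UpperSemicontinuous (f a)) :
    ∃ s : ℕ → ι, ∀ w, ⨅ a, f a w = ⨅ n, f (s n) w := by
  obtain ⟨T, hT, hTU⟩ := TopologicalSpace.isOpen_iUnion_countable
    (fun a => {z : X × EReal | f a z.1 < z.2}) fun a => by
      rw [isOpen_iff_mem_nhds]
      rintro ⟨w, c⟩ (hc : f a w < c)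
      obtain ⟨d, hd, hdc⟩ := exists_between hc
      rw [nhds_prod_eq]
      filter_upwards [(hf a w d hd).prod_mk (eventually_gt_nhds hdc)] with z hz
      exact hz.1.trans hz.2
  obtain ⟨a₀⟩ := ‹Nonempty ι›
  obtain ⟨s, hs⟩ := (hT.insert a₀).exists_eq_range (Set.insert_nonempty a₀ T)
  refine ⟨s, fun w => le_antisymm (le_iInf fun n => iInf_le _ _) (le_iInf fun a => ?_)⟩
  refine le_of_forall_gt fun c hc => ?_
  have hmem : (w, c) ∈ ⋃ a ∈ T, {z : X × EReal | f a z.1 < z.2} :=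
    hTU ▸ Set.mem_iUnion.2 ⟨a, hc⟩
  simp only [Set.mem_iUnion] at hmem
  obtain ⟨a', ha', h⟩ := hmem
  obtain ⟨n, rfl⟩ : a' ∈ Set.range s := hs ▸ Set.mem_insert_of_mem _ ha'
  exact (iInf_le _ n).trans_lt h

/-! ### Almost optimal chains of states -/

theorem exists_real_lt_of_lt_add {x y : EReal} (hx : x ≠ ⊤) {v : ℝ} (h : (v : EReal) < x + y) :
    ∃ v' : ℝ, (v' : EReal) < y ∧ x + v' = v := by
  have hbot : x ≠ ⊥ := by
    rintro rfl
    rw [EReal.bot_add] at h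
    exact not_lt_bot h
  lift x to ℝ using ⟨hx, hbot⟩
  refine ⟨v - x, ?_, by rw [← EReal.coe_add, add_sub_cancel]⟩
  rw [EReal.coe_sub]
  exact EReal.sub_lt_of_lt_add (by rwa [add_comm])

/-- One link of a chain. From a state `k` with `v < u k`, the kernel `E` (either `A*` or `A⁺`)
leads to a state `k'` with `v' < u k'` that is close to a point `ξ` charged by `ν`. -/
theorem exists_link (hp : ∀ j, green A b j = p j) {E : S → S → EReal}
    (hE : ∀ i j, E i j ≤ green A i j) (hEadd : ∀ i j k, E i j + green A j k ≤ E i k)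
    (hEu : ∀ k (v : ℝ), (v : EReal) < u k →
      ∃ k' : S, ∃ v' : ℝ, (v' : EReal) < u k' ∧ (v : EReal) ≤ E k k' + v')
    {ν : Measure (columns A b ∪ minimalMartinSpace A b)} (hν : ν.Represents u)
    {W : (S → EReal) → Set (S → EReal)} (hW : ∀ w, W w ∈ nhds w)
    {k : S} {v : ℝ} (hv : (v : EReal) < u k) :
    ∃ k' : S, ∃ v' : ℝ, ∃ ξ : ↥(columns A b ∪ minimalMartinSpace A b), (v' : EReal) < u k' ∧
      (v : EReal) ≤ E k k' + v' ∧ martinKernel A b k' ∈ W ξ.1 ∧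
      ((p k + v : ℝ) : EReal) ≤ ν.density ξ := by
  -- `E` is applied before `ν` is consulted, so that the final state `k'` is the one close to `ξ`.
  obtain ⟨k₁, v₁, hv₁, h₁⟩ := hEu k v hv
  rw [hν k₁] at hv₁
  obtain ⟨ξ, hξ⟩ := lt_iSup_iff.1 hv₁
  have hξM : ξ.1 ∈ martinSpace A b := ξ.2.elim (fun h => subset_closure h) fun h => h.1
  have hbot : ν.density ξ ≠ ⊥ := by
    intro h
    rw [h, EReal.add_bot] at hξ
    exact not_lt_bot hξ
  obtain ⟨r, hr⟩ : ∃ r : ℝ, (r : EReal) = ν.density ξ :=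
    ⟨_, EReal.coe_toReal (ν.ne_top ξ) hbot⟩
  rw [← hr] at hξ
  obtain ⟨k', hk'W, hk'⟩ := exists_lt_green_add hp ξ.2 (hW ξ.1) k₁
    (c := ((v₁ - r : ℝ) : EReal)) (by
      rw [EReal.coe_sub]
      exact EReal.sub_lt_of_lt_add hξ)
  have hlt : (v₁ : EReal) < green A k₁ k' + u k' := by
    have h₂ := EReal.add_lt_add_right_coe hk' r
    rw [← EReal.coe_add, sub_add_cancel, add_assoc, hr] at h₂
    exact h₂.trans_le (add_le_add le_rfl (hν.apply_add_le ξ k'))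
  obtain ⟨v', hv', hgv⟩ := exists_real_lt_of_lt_add (green_ne_top hp k₁ k') hlt
  refine ⟨k', v', ξ, hv', ?_, hk'W, ?_⟩
  · calc (v : EReal) ≤ E k k₁ + v₁ := h₁
      _ = E k k₁ + green A k₁ k' + v' := by rw [← hgv, add_assoc]
      _ ≤ _ := by gcongr; exact hEadd k k₁ k'
  · have h₃ : (v₁ : EReal) < ((-p k₁ + r : ℝ) : EReal) := by
      rw [EReal.coe_add]
      exact hξ.trans_le (by gcongr; exact apply_le_of_mem_martinSpace hp hξM k₁)
    have h₄ : (v : EReal) ≤ ((p k₁ - p k + v₁ : ℝ) : EReal) := by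
      rw [EReal.coe_add]
      exact h₁.trans (by gcongr; exact (hE k k₁).trans (green_le hp k k₁))
    rw [EReal.coe_lt_coe_iff] at h₃
    rw [EReal.coe_le_coe_iff] at h₄
    rw [← hr, EReal.coe_le_coe_iff]
    linarith

/-- Iterating `exists_link`, with `ν n` used at the link from `k n` to `k (n + 1)`. The column of
`k (n + 1)` is within `1 / (n + 1)` of `ξ n`, so the points `ξ n` converge with the columns. -/
theorem exists_chain [Countable S] (hp : ∀ j, green A b j = p j) {E : S → S → EReal}
    (hE : ∀ i j, E i j ≤ green A i j) (hEadd : ∀ i j k, E i j + green A j k ≤ E i k)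
    (hEu : ∀ k (v : ℝ), (v : EReal) < u k →
      ∃ k' : S, ∃ v' : ℝ, (v' : EReal) < u k' ∧ (v : EReal) ≤ E k k' + v')
    {ν : ℕ → Measure (columns A b ∪ minimalMartinSpace A b)} (hν : ∀ n, (ν n).Represents u)
    {i : S} {α : ℝ} (hα : (α : EReal) < u i) :
    ∃ (k : ℕ → S) (v : ℕ → ℝ) (ξ : ℕ → ↥(columns A b ∪ minimalMartinSpace A b)),
      k 0 = i ∧ v 0 = α ∧ (∀ n, (v n : EReal) < u (k n)) ∧
      (∀ n, (v n : EReal) ≤ E (k n) (k (n + 1)) + v (n + 1)) ∧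
      (∀ n, ((p (k n) + v n : ℝ) : EReal) ≤ (ν n).density (ξ n)) ∧
      ∀ w, Filter.Tendsto (fun n => martinKernel A b (k n)) Filter.atTop (nhds w) →
        Filter.Tendsto (fun n => (ξ n).1) Filter.atTop (nhds w) := by
  let _ := TopologicalSpace.metrizableSpaceMetric (S → EReal)
  have step : ∀ (n : ℕ) (x : {x : S × ℝ // (x.2 : EReal) < u x.1}),
      ∃ y : {x : S × ℝ // (x.2 : EReal) < u x.1} × ↥(columns A b ∪ minimalMartinSpace A b),
        (x.1.2 : EReal) ≤ E x.1.1 y.1.1.1 + y.1.1.2 ∧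
        martinKernel A b y.1.1.1 ∈ Metric.ball y.2.1 (1 / ((n : ℝ) + 1)) ∧
        ((p x.1.1 + x.1.2 : ℝ) : EReal) ≤ (ν n).density y.2 := by
    rintro n ⟨⟨k, v⟩, hv⟩
    obtain ⟨k', v', ξ, h₁, h₂, h₃, h₄⟩ := exists_link hp hE hEadd hEu (hν n)
      (W := fun w => Metric.ball w (1 / ((n : ℝ) + 1)))
      (fun w => Metric.ball_mem_nhds w Nat.one_div_pos_of_nat) hv
    exact ⟨⟨⟨⟨k', v'⟩, h₁⟩, ξ⟩, h₂, h₃, h₄⟩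
  choose next h₁ h₂ h₃ using step
  let x : ℕ → {x : S × ℝ // (x.2 : EReal) < u x.1} :=
    fun n => Nat.rec ⟨(i, α), hα⟩ (fun n y => (next n y).1) n
  refine ⟨fun n => (x n).1.1, fun n => (x n).1.2, fun n => (next n (x n)).2, rfl, rfl,
    fun n => (x n).2, fun n => h₁ n (x n), fun n => h₃ n (x n), fun w hw => ?_⟩
  refine (tendsto_iff_of_dist ?_).1 ((Filter.tendsto_add_atTop_iff_nat 1).2 hw)
  exact squeeze_zero (fun _ => dist_nonneg) (fun n => (h₂ n (x n)).le)
    tendsto_one_div_add_atTop_nhds_zero_nat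

section Limit

variable {k : ℕ → S} {v : ℕ → ℝ}

/-- The columns along an almost optimal chain converge, since `A*_{j k_n} + v_n` is monotone
in `n` for each `j`. -/
theorem exists_limit_of_chain (hp : ∀ j, green A b j = p j) (hu : IsSuperharmonic A u)
    (hub : u b ≠ ⊤) (hv : ∀ n, (v n : EReal) < u (k n))
    (hk : ∀ n, (v n : EReal) ≤ green A (k n) (k (n + 1)) + v (n + 1)) :
    ∃ (w : S → EReal) (a : ℝ),
      Filter.Tendsto (fun n => martinKernel A b (k n)) Filter.atTop (nhds w) ∧
      Filter.Tendsto (fun n => p (k n) + v n) Filter.atTop (nhds a) ∧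
      (∀ j n, green A j (k n) + v n ≤ w j + a) ∧
      ∀ j, Filter.Tendsto (fun n => green A j (k n) + v n) Filter.atTop (nhds (w j + a)) := by
  have hmono : ∀ j, Monotone fun n => green A j (k n) + v n := fun j =>
    monotone_nat_of_le_succ fun n => calc
      green A j (k n) + v n ≤ green A j (k n) + (green A (k n) (k (n + 1)) + v (n + 1)) := by
        gcongr; exact hk n
      _ ≤ green A j (k (n + 1)) + v (n + 1) := by
        rw [← add_assoc]; gcongr; exact green_add_green_le A _ _ _
  have hbound : ∀ j n, green A j (k n) + v n ≤ u j := fun j n =>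
    (add_le_add le_rfl (hv n).le).trans (hu.green_add_le j (k n))
  obtain ⟨B, hB⟩ : ∃ B : ℝ, (B : EReal) = u b := by
    refine ⟨_, EReal.coe_toReal hub fun h => ?_⟩
    have h₀ := hbound b 0
    rw [hp, ← EReal.coe_add, h] at h₀
    exact EReal.coe_ne_bot _ (le_bot_iff.1 h₀)
  obtain ⟨a, ha⟩ : ∃ a, Filter.Tendsto (fun n => p (k n) + v n) Filter.atTop (nhds a) := by
    refine ⟨_, tendsto_atTop_ciSup (fun m n hmn => ?_) ⟨B, ?_⟩⟩
    · have h := hmono b hmn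
      simp only [hp, ← EReal.coe_add, EReal.coe_le_coe_iff] at h
      exact h
    · rintro _ ⟨n, rfl⟩
      have h := hbound b n
      rw [hp, ← EReal.coe_add, ← hB, EReal.coe_le_coe_iff] at h
      exact h
  have hsum : ∀ j, (⨆ n, green A j (k n) + v n) - (a : EReal) + a = ⨆ n, green A j (k n) + v n :=
    fun j => EReal.sub_add_cancel
  refine ⟨fun j => (⨆ n, green A j (k n) + v n) - (a : EReal), a, ?_, ha, fun j n => ?_,
    fun j => ?_⟩
  · refine tendsto_pi_nhds.2 fun j => ?_
    have h : (fun n => martinKernel A b (k n) j) =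
        fun n => green A j (k n) + v n + ((-(p (k n) + v n) : ℝ) : EReal) := by
      funext n
      rw [martinKernel_apply hp, add_assoc, ← EReal.coe_add, sub_eq_add_neg, ← EReal.coe_neg]
      congr 2
      ring
    rw [h, sub_eq_add_neg, ← EReal.coe_neg]
    exact (EReal.continuousAt_add (p := (_, ((-a : ℝ) : EReal))) (by simp) (by simp)).tendsto.comp
      ((tendsto_atTop_iSup (hmono j)).prodMk_nhds
        ((continuous_coe_real_ereal.tendsto _).comp ha.neg))
  · rw [hsum]
    exact le_iSup (fun n => green A j (k n) + v n) n
  · rw [hsum]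
    exact tendsto_atTop_iSup (hmono j)

variable {w : S → EReal} {a : ℝ}

/-- The limit of a chain, if not a column, is minimal: the states `k n` have columns close to `w`
and `p (k n) + w (k n) ≥ p (k n) + v n - a`, which tends to `0`. -/
theorem mem_columns_union_minimal_of_chain (hp : ∀ j, green A b j = p j)
    (hw : Filter.Tendsto (fun n => martinKernel A b (k n)) Filter.atTop (nhds w))
    (ha : Filter.Tendsto (fun n => p (k n) + v n) Filter.atTop (nhds a))
    (hle : ∀ j n, green A j (k n) + v n ≤ w j + a) :
    w ∈ columns A b ∪ minimalMartinSpace A b := by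
  refine or_iff_not_imp_left.2 fun hcol => ?_
  have hwM : w ∈ martinSpace A b :=
    mem_closure_of_tendsto hw (Filter.Eventually.of_forall fun n => ⟨k n, rfl⟩)
  refine mem_minimal_of_forall_lt hp hwM fun c hc => ?_
  have hknear : Filter.Tendsto k Filter.atTop (nearPoint A b w) := Filter.tendsto_comap_iff.2 hw
  refine hknear.frequently (Filter.Eventually.frequently ?_)
  have hlim : Filter.Tendsto (fun n => ((p (k n) + v n - a : ℝ) : EReal)) Filter.atTop
      (nhds ((0 : ℝ) : EReal)) :=
    (continuous_coe_real_ereal.tendsto _).comp (by simpa using ha.sub_const a)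
  filter_upwards [hlim.eventually_const_lt hc] with n hn
  constructor
  -- As `w` is not a column, states `j` with `K_{·j}` close to `w` differ from `k n`.
  · have hne : ∀ᶠ j in nearPoint A b w, martinKernel A b j ≠ martinKernel A b (k n) :=
      Filter.tendsto_comap.eventually_ne fun h => hcol ⟨k n, h.symm⟩
    exact hne.mono fun j hj => greenPlus_eq_green_of_ne A fun h => hj (by rw [h])
  · refine hn.trans_le ?_
    have h := hle (k n) n
    rw [green_self hp, zero_add] at h
    have h' : ((v n - a : ℝ) : EReal) ≤ w (k n) := by
      rw [EReal.coe_sub, EReal.sub_le_iff_le_add (by simp) (by simp)]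
      exact h
    rw [add_sub_assoc, EReal.coe_add]
    gcongr

/-- If every link of the chain is a path of positive length, then the limit of the chain is in
the minimal Martin space even if it is a column: a limiting column `K_{·m}` forces
`A⁺_{mm} = 0`. -/
theorem mem_minimal_of_chain (hp : ∀ j, green A b j = p j)
    (hk : ∀ n, (v n : EReal) ≤ greenPlus A (k n) (k (n + 1)) + v (n + 1))
    (hw : Filter.Tendsto (fun n => martinKernel A b (k n)) Filter.atTop (nhds w))
    (ha : Filter.Tendsto (fun n => p (k n) + v n) Filter.atTop (nhds a))
    (hle : ∀ j n, green A j (k n) + v n ≤ w j + a)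
    (hlim : ∀ j, Filter.Tendsto (fun n => green A j (k n) + v n) Filter.atTop
      (nhds (w j + a))) :
    w ∈ minimalMartinSpace A b := by
  rcases mem_columns_union_minimal_of_chain hp hw ha hle with ⟨m, rfl⟩ | h
  swap
  · exact h
  refine martinKernel_mem_minimal hp ?_
  have hval : ∀ j, martinKernel A b m j + a = green A j m + ((a - p m : ℝ) : EReal) := by
    intro j
    rw [martinKernel_apply hp, sub_eq_add_neg, add_assoc, ← EReal.coe_neg, ← EReal.coe_add]
    congr 2
    ring
  have hbound : ∀ n, green A m (k n) + v n ≤ greenPlus A m m + ((a - p m : ℝ) : EReal) := by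
    intro n
    have h := hle (k (n + 1)) (n + 1)
    rw [green_self hp, zero_add, hval] at h
    calc green A m (k n) + v n
        ≤ green A m (k n) + (greenPlus A (k n) (k (n + 1)) + v (n + 1)) := by
          gcongr; exact hk n
      _ ≤ greenPlus A m (k (n + 1)) + (green A (k (n + 1)) m + ((a - p m : ℝ) : EReal)) := by
          rw [← add_assoc]
          gcongr
          exact green_add_greenPlus_le A _ _ _
      _ ≤ _ := by
          rw [← add_assoc]
          gcongr
          exact greenPlus_add_green_le A _ _ _
  have h := le_of_tendsto' (hlim m) hbound
  rw [hval, green_self hp] at h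
  exact not_lt.1 fun hlt => not_lt.2 h (EReal.add_lt_add_right_coe hlt _)

end Limit

/-- Upper semicontinuity along a sequence: it is enough that the lower bounds `r n` for
`ν.density (ξ n)` hold infinitely often. -/
theorem Measure.le_density_of_tendsto {D : Set (S → EReal)} {ν : Measure D} {ξ : ℕ → D} {w : D}
    (hξ : Filter.Tendsto ξ Filter.atTop (nhds w)) {r : ℕ → ℝ} {a : ℝ}
    (hr : Filter.Tendsto r Filter.atTop (nhds a))
    (h : ∃ᶠ n in Filter.atTop, (r n : EReal) ≤ ν.density (ξ n)) : (a : EReal) ≤ ν.density w := by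
  by_contra! hlt
  obtain ⟨c, hc, hca⟩ := exists_between hlt
  have hr' := ((continuous_coe_real_ereal.tendsto a).comp hr).eventually_const_lt hca
  obtain ⟨n, hn, hn₁, hn₂⟩ := (h.and_eventually (hr'.and (hξ.eventually (ν.usc w c hc)))).exists
  exact lt_irrefl c ((lt_of_lt_of_le hn₁ hn).trans hn₂)

/-- Any sequence of representing measures gives values at least `α` at a common point: that point
is the limit of a chain which uses every measure of the sequence infinitely often. -/
theorem exists_common_point [Countable S] (hp : ∀ j, green A b j = p j)
    (hu : IsSuperharmonic A u) (hub : u b ≠ ⊤)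
    {ν : ℕ → Measure (columns A b ∪ minimalMartinSpace A b)} (hν : ∀ n, (ν n).Represents u)
    {i : S} {α : ℝ} (hα : (α : EReal) < u i) :
    ∃ w : ↥(columns A b ∪ minimalMartinSpace A b),
      (IsHarmonic A u → w.1 ∈ minimalMartinSpace A b) ∧
      ∃ a : ℝ, (α : EReal) ≤ w.1 i + a ∧ ∀ n, (a : EReal) ≤ (ν n).density w := by
  -- The measures are used in the order `n ↦ n.unpair.1`, which takes every value infinitely often.
  obtain ⟨k, v, ξ, hk0, hv0, hv, hk, hkplus, hξν, hξ⟩ : ∃ (k : ℕ → S) (v : ℕ → ℝ)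
      (ξ : ℕ → ↥(columns A b ∪ minimalMartinSpace A b)),
      k 0 = i ∧ v 0 = α ∧ (∀ n, (v n : EReal) < u (k n)) ∧
      (∀ n, (v n : EReal) ≤ green A (k n) (k (n + 1)) + v (n + 1)) ∧
      (IsHarmonic A u → ∀ n, (v n : EReal) ≤ greenPlus A (k n) (k (n + 1)) + v (n + 1)) ∧
      (∀ n, ((p (k n) + v n : ℝ) : EReal) ≤ (ν n.unpair.1).density (ξ n)) ∧
      ∀ w, Filter.Tendsto (fun n => martinKernel A b (k n)) Filter.atTop (nhds w) →
        Filter.Tendsto (fun n => (ξ n).1) Filter.atTop (nhds w) := by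
    by_cases har : IsHarmonic A u
    · obtain ⟨k, v, ξ, h₁, h₂, h₃, h₄, h₅⟩ := exists_chain hp (E := greenPlus A)
        (greenPlus_le_green A) (greenPlus_add_green_le A) (fun k v hv => by
          rw [har k] at hv
          obtain ⟨j, hj⟩ := lt_iSup_iff.1 hv
          have hj : (v : EReal) < greenPlus A k j + u j :=
            hj.trans_le (add_le_add (le_greenPlus A k j) le_rfl)
          obtain ⟨v', hv', hgv⟩ := exists_real_lt_of_lt_add
            (ne_top_of_le_ne_top (green_ne_top hp k j) (greenPlus_le_green A k j)) hj
          exact ⟨j, v', hv', hgv.ge⟩)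
        (ν := fun n => ν n.unpair.1) (fun n => hν _) hα
      exact ⟨k, v, ξ, h₁, h₂, h₃,
        fun n => (h₄ n).trans (add_le_add (greenPlus_le_green A _ _) le_rfl), fun _ => h₄, h₅⟩
    · obtain ⟨k, v, ξ, h₁, h₂, h₃, h₄, h₅⟩ := exists_chain hp (E := green A)
        (fun _ _ => le_rfl) (green_add_green_le A)
        (fun k v hv => ⟨k, v, hv, by rw [green_self hp, zero_add]⟩)
        (ν := fun n => ν n.unpair.1) (fun n => hν _) hα
      exact ⟨k, v, ξ, h₁, h₂, h₃, h₄, fun h => absurd h har, h₅⟩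
  obtain ⟨w, a, hw, ha, hle, hlim⟩ := exists_limit_of_chain hp hu hub hv hk
  refine ⟨⟨w, mem_columns_union_minimal_of_chain hp hw ha hle⟩,
    fun har => mem_minimal_of_chain hp (hkplus har) hw ha hle hlim, a, ?_, fun m => ?_⟩
  · have h := hle i 0
    rwa [hk0, hv0, green_self hp, zero_add] at h
  · refine Measure.le_density_of_tendsto (tendsto_subtype_rng.2 (hξ w hw)) ha ?_
    refine Filter.frequently_atTop.2 fun N => ⟨Nat.pair m N, Nat.right_le_pair m N, ?_⟩
    have h := hξν (Nat.pair m N)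
    rwa [Nat.unpair_pair] at h

end MaxPlus

/-! ### The least representing measure -/

open MaxPlus in
theorem theorem1p1 {S : Type*} [Countable S] (A : S → S → EReal) (hA : ∀ i j, A i j ≠ ⊤)
    (b : S) (hb : ∀ j, MaxPlus.green A b j ≠ ⊥) (hfin : ∀ j, MaxPlus.green A b j ≠ ⊤)
    (u : S → EReal) (hu : ∀ i, u i ≠ ⊤) (hsuper : MaxPlus.IsSuperharmonic A u) :
    ∃ μ : MaxPlus.Measure (MaxPlus.columns A b ∪ MaxPlus.minimalMartinSpace A b),
      IsLeast {ν : MaxPlus.Measure (MaxPlus.columns A b ∪ MaxPlus.minimalMartinSpace A b) |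
        ν.Represents u} μ ∧
      (MaxPlus.IsHarmonic A u →
        IsLeast {ν : MaxPlus.Measure (MaxPlus.minimalMartinSpace A b) | ν.Represents u}
          (μ.restrict Set.subset_union_right)) := by
  obtain ⟨p, hp⟩ : ∃ p : S → ℝ, ∀ j, green A b j = p j :=
    ⟨fun j => (green A b j).toReal, fun j => (EReal.coe_toReal (hfin j) (hb j)).symm⟩
  obtain ⟨ν₀, hν₀⟩ := exists_represents hp (hu b) hsuper
  let R := {ν : Measure (columns A b ∪ minimalMartinSpace A b) // ν.Represents u}
  have : Nonempty R := ⟨⟨ν₀, hν₀⟩⟩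
  obtain ⟨s, hs⟩ := exists_seq_iInf_eq (f := fun ν : R => ν.1.density) fun ν => ν.1.usc
  let μ : Measure (columns A b ∪ minimalMartinSpace A b) :=
    { density := fun w => ⨅ ν : R, ν.1.density w
      ne_top := fun w => ne_top_of_le_ne_top (ν₀.ne_top w) (iInf_le _ (⟨ν₀, hν₀⟩ : R))
      usc := upperSemicontinuous_iInf fun ν : R => ν.1.usc }
  have hμle : ∀ ν : R, ∀ w, μ.density w ≤ ν.1.density w := fun ν w => iInf_le _ ν
  have hupper : ∀ w i, w.1 i + μ.density w ≤ u i := fun w i =>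
    (add_le_add le_rfl (hμle ⟨ν₀, hν₀⟩ w)).trans (hν₀.apply_add_le w i)
  have hpoint : ∀ i (α : ℝ), (α : EReal) < u i →
      ∃ w : ↥(columns A b ∪ minimalMartinSpace A b),
        (IsHarmonic A u → w.1 ∈ minimalMartinSpace A b) ∧ (α : EReal) ≤ w.1 i + μ.density w := by
    intro i α hα
    obtain ⟨w, hw, a, hα', ha⟩ := exists_common_point hp hsuper (hu b)
      (ν := fun n => (s n).1) (fun n => (s n).2) hα
    refine ⟨w, hw, hα'.trans (add_le_add le_rfl ?_)⟩
    exact (le_iInf ha).trans (hs w).ge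
  refine ⟨μ, ⟨fun i => ?_, fun ν hν => hμle ⟨ν, hν⟩⟩, fun har => ⟨fun i => ?_, ?_⟩⟩
  · refine le_antisymm (EReal.ge_of_forall_gt_iff_ge.1 fun α hα => ?_)
      (iSup_le fun w => hupper w i)
    obtain ⟨w, -, hw⟩ := hpoint i α hα
    exact hw.trans (le_iSup (fun w : ↥(columns A b ∪ minimalMartinSpace A b) =>
      w.1 i + μ.density w) w)
  · refine le_antisymm (EReal.ge_of_forall_gt_iff_ge.1 fun α hα => ?_)
      (iSup_le fun w => hupper (Set.inclusion Set.subset_union_right w) i)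
    obtain ⟨w, hwm, hw⟩ := hpoint i α hα
    exact hw.trans (le_iSup (fun w : ↥(minimalMartinSpace A b) =>
      w.1 i + (μ.restrict Set.subset_union_right).density w) ⟨w.1, hwm har⟩)
  · intro ν hν w
    obtain ⟨ν', hν', heq⟩ := hν.exists_extension (D := columns A b ∪ minimalMartinSpace A b)
      Set.subset_union_right (fun w hw => apply_basepoint_of_mem_union hp hw) (hu b)
    exact (hμle ⟨ν', hν'⟩ _).trans (heq w).le
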